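/- Let $q$ be a prime power, $n>1$, $K=\mathbb F_{q^n}$ and $N=\frac{q^n-1}{q-1}$. A polynomial in $K[t]$ is called $(n,q)$-quasi-symmetric if it has the form $\mathbf f(t,t^q,\dots,t^{q^{n-1}})$ for some $\mathbf f\in K[X_1,\dots,X_n]$ that is fixed by the cyclic permutation $(1\,2\,\cdots\,n)$ of the variables. Let $g,h$ be $(n,q)$-quasi-symmetric polynomials with coefficients in $\mathbb F_q$, without zeros in $\mathbb F_{q^n}$, and with $\deg g\neq\deg h$. Let $F_1\subseteq F_2\subseteq\cdots$ be a tower of fields, where $F_1=K(x_1)$ is the rational function field and, for $i\ge 1$, $F_{i+1}=F_i(x_{i+1})$ with $$x_{i+1}^{N}=\frac{g(x_i)}{h(x_i)},$$ and suppose that for every $i\ge1$ the element $g(x_i)/h(x_i)$ is not of the form $w^{N}$ with $w\in F_i$. Then all rational places (places of degree one over $K$), except possibly those at infinity, split completely throughout the tower: with $P_\infty$ the pole of $x_1$ in $F_1$, for all $1\le i\le j$, every rational place $P$ of $F_i$ that does not lie above $P_\infty$ splits completely in $F_j$, i.e. $[F_j:F_i]$ is finite and exactly $[F_j:F_i]$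 places of $F_j$ lie above $P$. In particular (the case $i=1$), every rational place of $F_1$ other than $P_\infty$ splits completely in every $F_j$. -/

import Mathlib

open scoped Polynomial

noncomputable section

/-- A polynomial in `n` variables is quasi-symmetric if it is fixed by the cyclic permutation
`(1 2 … n)` of the variables. -/
def IsQuasiSymmetric {R : Type*} [CommSemiring R] {n : ℕ} (f : MvPolynomial (Fin n) R) : Prop :=
  MvPolynomial.rename (finRotate n) f = f

/-- The `(n, q)`-quasi-symmetric polynomials: values `f(t, t^q, …, t^(q^(n-1)))` of
quasi-symmetric polynomials `f` in `n` variables. -/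
def IsNQQuasiSymmetric {R : Type*} [CommSemiring R] (n q : ℕ) (g : R[X]) : Prop :=
  ∃ f : MvPolynomial (Fin n) R, IsQuasiSymmetric f ∧
    g = MvPolynomial.aeval (fun i : Fin n => (Polynomial.X : R[X]) ^ q ^ (i : ℕ)) f

/-- A place of `F / K`, given by its valuation ring `K ⊆ 𝒪 ⊊ F` (then `K ≠ 𝒪` automatically when
`F` is a function field over `K`, since a field `𝒪` would be all of `F`). -/
@[ext]
structure Place (K F : Type*) [Field K] [Field F] [Algebra K F] extends ValuationSubring F where
  algebraMap_mem' : ∀ a : K, algebraMap K F a ∈ toValuationSubring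
  ne_top' : toValuationSubring ≠ ⊤

namespace Place

/-- The residue class field of a place. -/
abbrev ResidueField {K F : Type*} [Field K] [Field F] [Algebra K F] (P : Place K F) : Type _ :=
  IsLocalRing.ResidueField P.toValuationSubring

/-- The embedding of `K` into the residue class field of a place. -/
def constMap {K F : Type*} [Field K] [Field F] [Algebra K F] (P : Place K F) :
    K →+* P.ResidueField :=
  (IsLocalRing.residue P.toValuationSubring).comp
    ((algebraMap K F).codRestrict P.toValuationSubring P.algebraMap_mem')

/-- The degree of a place: the dimension over `K` of its residue class field (with the junk value
`0` if this is infinite, which does not happen for function fields). -/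
def degree {K F : Type*} [Field K] [Field F] [Algebra K F] (P : Place K F) : ℕ :=
  @Module.finrank K P.ResidueField _ _ P.constMap.toModule

/-- Rational places are the places of degree one. -/
def IsRational {K F : Type*} [Field K] [Field F] [Algebra K F] (P : Place K F) : Prop :=
  P.degree = 1

/-- `P` is a pole of `z`: `z` is not in the valuation ring of `P`. -/
def IsPole {K F : Type*} [Field K] [Field F] [Algebra K F] (P : Place K F) (z : F) : Prop :=
  z ∉ P.toValuationSubring

/-- The place `P'` of `E` lies above the place `P` of `F`, where `F` is embedded in `E` by `φ`:
`𝒪_P = 𝒪_P' ∩ F`. -/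
def LiesAbove {K F E : Type*} [Field K] [Field F] [Field E] [Algebra K F] [Algebra K E]
    (φ : F →ₐ[K] E) (P' : Place K E) (P : Place K F) : Prop :=
  P'.toValuationSubring.comap (φ : F →+* E) = P.toValuationSubring

/-- `P` splits completely in the extension `E / F` (given by the embedding `φ`): the extension is
finite, and exactly `[E : F]` distinct places of `E` lie above `P`. -/
def SplitsCompletely {K F E : Type*} [Field K] [Field F] [Field E] [Algebra K F] [Algebra K E]
    (φ : F →ₐ[K] E) (P : Place K F) : Prop :=
  letI : Module F E := (φ : F →+* E).toModule
  FiniteDimensional F E ∧ {P' : Place K E | LiesAbove φ P' P}.ncard = Module.finrank F E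

end Place

/-- The field `F_i = K(x_1, …, x_i)`, inside a field `Ω` that contains all the `x_i`. -/
def towerField (K : Type*) {Ω : Type*} [Field K] [Field Ω] [Algebra K Ω] (x : ℕ → Ω) (i : ℕ) :
    IntermediateField K Ω :=
  IntermediateField.adjoin K (x '' Set.Icc 1 i)

theorem towerField_mono (K : Type*) {Ω : Type*} [Field K] [Field Ω] [Algebra K Ω] (x : ℕ → Ω)
    {i j : ℕ} (hij : i ≤ j) : towerField K x i ≤ towerField K x j :=
  IntermediateField.adjoin.mono K _ _ (Set.image_mono (Set.Icc_subset_Icc_right hij))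

theorem mem_towerField (K : Type*) {Ω : Type*} [Field K] [Field Ω] [Algebra K Ω] (x : ℕ → Ω)
    {i j : ℕ} (hi : 1 ≤ i) (hij : i ≤ j) : x i ∈ towerField K x j :=
  IntermediateField.subset_adjoin K _ ⟨i, ⟨hi, hij⟩, rfl⟩

end

/-! Let `P` be a rational place of `F_i` at which `x_1` is regular. As `h` has no zeros in `K`,
every generator up to `x_i` is regular at `P`; let `a ∈ K` be the residue of `x_i`. Then
`g(x_i)/h(x_i)` has residue `c = g(a)/h(a) ≠ 0`. Frobenius permutes `a, a^q, …, a^(q^(n-1))`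
cyclically and fixes the coefficients of `g` and `h`, so `c ∈ 𝔽_q`
(`IsNQQuasiSymmetric.eval_pow_eq`). The norm `z ↦ z^N` maps `Kˣ` onto `𝔽_qˣ`, so `T^N - c` has `N`
distinct roots in `K` (`card_nthRoots_of_pow_eq_self`).

A Dedekind–Kummer argument (`Place.ncard_liesAbove_of_kummer`) matches the places above `P` with the
roots of the reduced minimal polynomial of `x_{i+1}`. This divides `T^N - c`, so it has as many
roots in `K` as its degree `[F_{i+1} : F_i]`. The places above are again rational with `x_1`
regular, so the argument repeats; place counts and degrees both multiply along the tower
(`Place.SplitsCompletely.trans`). -/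

noncomputable section

/-! ### Valuation rings and integral elements in extensions -/

namespace ValuationSubring

variable {F E : Type*} [Field F] [Field E] [Algebra F E]

theorem sub_mem_nonunits {A : ValuationSubring F} {x y : F} (hx : x ∈ A.nonunits)
    (hy : y ∈ A.nonunits) : x - y ∈ A.nonunits :=
  (mem_nonunits_iff _).2 (A.valuation.map_sub_lt hx hy)

theorem add_mem_nonunits {A : ValuationSubring F} {x y : F} (hx : x ∈ A.nonunits)
    (hy : y ∈ A.nonunits) : x + y ∈ A.nonunits :=
  (mem_nonunits_iff _).2 (A.valuation.map_add_lt hx hy)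

theorem mul_mem_nonunits {A : ValuationSubring F} {x y : F} (hx : x ∈ A)
    (hy : y ∈ A.nonunits) : x * y ∈ A.nonunits := by
  rw [mem_nonunits_iff, map_mul]
  exact (mul_le_of_le_one_left' ((A.valuation_le_one_iff x).2 hx)).trans_lt
    ((mem_nonunits_iff _).1 hy)

theorem one_notMem_nonunits (A : ValuationSubring F) : (1 : F) ∉ A.nonunits := by
  simp [mem_nonunits_iff]

theorem zero_mem_nonunits (A : ValuationSubring F) : (0 : F) ∈ A.nonunits := by
  simp

theorem mem_of_mem_nonunits {A : ValuationSubring F} {x : F} (hx : x ∈ A.nonunits) : x ∈ A :=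
  A.nonunits_subset hx

theorem inv_mem_of_notMem_nonunits {A : ValuationSubring F} {x : F} (hx : x ∉ A.nonunits) :
    x⁻¹ ∈ A := by
  by_contra h
  exact hx ((mem_nonunits_iff_or _).2 (Or.inr h))

theorem mem_or_mem_of_mul_mem_nonunits {A : ValuationSubring F} {x y : F}
    (h : x * y ∈ A.nonunits) : x ∈ A.nonunits ∨ y ∈ A.nonunits := by
  by_contra! h'
  simp only [mem_nonunits_iff, map_mul, not_lt] at h h'
  exact absurd h (not_lt.2 (one_le_mul h'.1 h'.2))

theorem exists_mem_nonunits_of_multiset_prod {A : ValuationSubring F} (s : Multiset F)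
    (h : s.prod ∈ A.nonunits) : ∃ x ∈ s, x ∈ A.nonunits := by
  induction s using Multiset.induction with
  | empty => exact absurd h (by simpa using A.one_notMem_nonunits)
  | cons a s ih =>
    rw [Multiset.prod_cons] at h
    rcases mem_or_mem_of_mul_mem_nonunits h with h | h
    · exact ⟨a, by simp, h⟩
    · obtain ⟨x, hx, hx'⟩ := ih h
      exact ⟨x, by simp [hx], hx'⟩

theorem mem_of_pow_mem {A : ValuationSubring F} {x : F} {N : ℕ} (hN : N ≠ 0)
    (h : x ^ N ∈ A) : x ∈ A := by
  rw [← valuation_le_one_iff, map_pow] at h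
  exact (A.valuation_le_one_iff x).1 ((pow_le_one_iff hN).1 h)

theorem map_mem_of_comap_eq {A : ValuationSubring F} {W : ValuationSubring E}
    (h : W.comap (algebraMap F E) = A) {x : F} : algebraMap F E x ∈ W ↔ x ∈ A := by
  rw [← h, mem_comap]

theorem map_mem_nonunits_of_comap_eq {A : ValuationSubring F} {W : ValuationSubring E}
    (h : W.comap (algebraMap F E) = A) {x : F} :
    algebraMap F E x ∈ W.nonunits ↔ x ∈ A.nonunits := by
  rw [mem_nonunits_iff_or, mem_nonunits_iff_or, ← map_inv₀, map_mem_of_comap_eq h]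
  simp

/-- An element lying in every valuation ring that contains `A` is integral over `A`. -/
theorem isIntegral_of_forall_mem (A : ValuationSubring F) {b : E}
    (h : ∀ O : ValuationSubring E, (∀ a ∈ A, algebraMap F E a ∈ O) → b ∈ O) :
    IsIntegral A b := by
  have : b ∈ (integralClosure A E).toSubring := by
    have : IsIntegrallyClosedIn (integralClosure A E).toSubring E :=
      inferInstanceAs (IsIntegrallyClosedIn (integralClosure A E) E)
    rw [Subring.eq_iInf_of_isIntegrallyClosedIn (R := (integralClosure A E).toSubring)]
    simp only [Subring.mem_iInf, Subtype.forall]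
    intro O hO
    exact h O fun a ha => hO ((integralClosure A E).algebraMap_mem ⟨a, ha⟩)
  exact this

/-- An algebraic element is a root of a polynomial with coefficients in `A`, one of them `1`. -/
theorem exists_primitive_aeval_eq_zero (A : ValuationSubring F) {z : E} (hz : IsAlgebraic F z) :
    ∃ p : F[X], Polynomial.aeval z p = 0 ∧ (∀ k, p.coeff k ∈ A) ∧ ∃ i, p.coeff i = 1 := by
  obtain ⟨q, hq0, hq⟩ := hz
  obtain ⟨i, hi, hmax⟩ := Finset.exists_max_image q.support (fun k => A.valuation (q.coeff k))
    (Polynomial.support_nonempty.2 hq0)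
  have hi0 : q.coeff i ≠ 0 := Polynomial.mem_support_iff.1 hi
  refine ⟨Polynomial.C (q.coeff i)⁻¹ * q, by simp [hq], fun k => ?_, i, by simp [hi0]⟩
  rw [Polynomial.coeff_C_mul, ← valuation_le_one_iff, map_mul, map_inv₀]
  by_cases hk : k ∈ q.support
  · have := hmax k hk
    rw [mul_comm, ← div_eq_mul_inv]
    exact div_le_one_of_le₀ this zero_le
  · rw [Polynomial.notMem_support_iff.1 hk]; simp

/-- If `W` lies above `A` and `z ∈ W`, then `z` is a fraction of elements integral over `A` with
denominator a unit of `W`. -/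
theorem exists_isIntegral_mul_isIntegral {A : ValuationSubring F} {W : ValuationSubring E}
    {z : E} (hz : IsAlgebraic F z) (hzW : z ∈ W) :
    ∃ s : E, IsIntegral A s ∧ IsIntegral A (s * z) ∧ s ∉ W.nonunits := by
  obtain ⟨p, hp0, hpA, i, hi⟩ := exists_primitive_aeval_eq_zero A hz
  -- These are the Horner tails `β k = p_k + p_{k+1} z + ⋯`. In a valuation ring containing `A`,
  -- they are visibly present if `z` is; if `z⁻¹` is, climb from `β 0 = 0` by `β (k+1) = (β k - p_k)
  -- z⁻¹`.
  let β : ℕ → E := fun k => Polynomial.aeval z (Polynomial.divX^[k] p)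
  have hcoeff : ∀ k j, (Polynomial.divX^[k] p).coeff j = p.coeff (j + k) := by
    intro k
    induction k with
    | zero => simp
    | succ k ih =>
      intro j
      rw [Function.iterate_succ_apply', Polynomial.coeff_divX, ih]
      congr 1; ring
  have hrec : ∀ k, β k = β (k + 1) * z + algebraMap F E (p.coeff k) := by
    intro k
    have h := congrArg (Polynomial.aeval z) (Polynomial.divX_mul_X_add (Polynomial.divX^[k] p))
    rw [hcoeff, zero_add, map_add, map_mul, Polynomial.aeval_X, Polynomial.aeval_C] at h
    simp only [β, Function.iterate_succ_apply']
    exact h.symm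
  have hβ0 : β 0 = 0 := hp0
  have hint : ∀ k, IsIntegral A (β k) := by
    intro k
    refine isIntegral_of_forall_mem A fun O hO => ?_
    rcases O.mem_or_inv_mem z with hz | hz
    · simp only [β, Polynomial.aeval_eq_sum_range]
      refine sum_mem fun j _ => ?_
      rw [Algebra.smul_def, hcoeff]
      exact O.mul_mem _ _ (hO _ (hpA _)) (pow_mem hz j)
    · by_cases hz0 : z = 0
      · subst hz0
        rw [hrec, mul_zero, zero_add]
        exact hO _ (hpA _)
      induction k with
      | zero => rw [hβ0]; exact O.zero_mem
      | succ k ih =>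
        have : β (k + 1) = (β k - algebraMap F E (p.coeff k)) * z⁻¹ := by
          rw [hrec k]; field_simp; ring
        rw [this]
        exact O.mul_mem _ _ (sub_mem ih (hO _ (hpA _))) hz
  -- Some `β (k+1)` serves as `s`, since `β (k+1) * z = β k - p_k` is integral. Otherwise all `β k`
  -- are nonunits of `W`, and so is `1 = p_i = β i - z * β (i+1)`.
  by_contra! hcon
  have hnon : ∀ k, β k ∈ W.nonunits := by
    intro k
    cases k with
    | zero => rw [hβ0]; exact W.zero_mem_nonunits
    | succ k =>
      refine hcon _ (hint _) ?_
      rw [show β (k + 1) * z = β k - algebraMap F E (p.coeff k) by rw [hrec k]; ring]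
      exact (hint k).sub (isIntegral_algebraMap (R := A) (A := E) (x := ⟨p.coeff k, hpA k⟩))
  have h1 : algebraMap F E (p.coeff i) = β i - z * β (i + 1) := by rw [hrec i]; ring
  rw [hi, map_one] at h1
  exact W.one_notMem_nonunits (h1 ▸ sub_mem_nonunits (hnon i) (mul_mem_nonunits hzW (hnon _)))

/-- If `E = F(y)` with `y ^ N = u`, where `u` and `N` are units of `A`, then all elements of `E`
integral over `A` lie in `A[y]`. -/
theorem exists_aeval_eq_of_isIntegral {A : ValuationSubring F} {y : E} {N : ℕ} {u : A}
    (hN : IsUnit (N : A)) (hu : IsUnit u) (hy : y ^ N = algebraMap A E u)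
    (hgen : IntermediateField.adjoin F {y} = ⊤) {β : E} (hβ : IsIntegral A β) :
    ∃ p : A[X], β = Polynomial.aeval y p := by
  have hN0 : N ≠ 0 := by
    rintro rfl
    simp at hN
  have hyint : IsIntegral A y := by
    refine IsIntegral.of_pow (Nat.pos_of_ne_zero hN0) ?_
    rw [hy]; exact isIntegral_algebraMap
  have hroot : Polynomial.aeval y (Polynomial.X ^ N - Polynomial.C u) = 0 := by simp [hy]
  obtain ⟨k, hk⟩ := minpoly.isIntegrallyClosed_dvd hyint hroot
  have hint (r : A[X]) : IsIntegral A (Polynomial.aeval y r) := by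
    rw [← Polynomial.aeval_subalgebra_coe r (integralClosure A E) ⟨y, hyint⟩]
    exact Subtype.prop _
  obtain ⟨u', hu'⟩ := hu.exists_right_inv
  obtain ⟨N', hN'⟩ := hN.exists_right_inv
  -- With `m` the minimal polynomial, differentiating `T^N - u = m k` at `y` gives `N y^(N-1) =
  -- m'(y) k(y)`. Multiplying by `y / (u N)` exhibits an inverse of `m'(y)` in `A[y]`.
  have hder : Polynomial.aeval y (Polynomial.derivative (minpoly A y)) *
      Polynomial.aeval y (k * Polynomial.X * Polynomial.C (u' * N')) = 1 := by
    have h := congrArg (fun r => Polynomial.aeval y (Polynomial.derivative r)) hk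
    simp only [Polynomial.derivative_X_pow, Polynomial.derivative_C,
      Polynomial.derivative_mul, map_add, map_mul, map_sub, minpoly.aeval, zero_mul, add_zero,
      sub_zero, Polynomial.aeval_C, Polynomial.aeval_X, map_pow, map_natCast] at h ⊢
    have h2 : y ^ (N - 1) * y = algebraMap A E u := by
      rw [← hy, ← pow_succ, Nat.sub_add_cancel (Nat.pos_of_ne_zero hN0)]
    have h3 : algebraMap A E u * algebraMap A E u' = 1 := by rw [← map_mul, hu', map_one]
    have h4 : (N : E) * algebraMap A E N' = 1 := by
      rw [← map_natCast (algebraMap A E), ← map_mul, hN', map_one]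
    linear_combination (-y * algebraMap A E u' * algebraMap A E N') * h +
      (N : E) * algebraMap A E u' * algebraMap A E N' * h2 + (N : E) * algebraMap A E N' * h3 + h4
  have hyF : IsIntegral F y := hyint.tower_top
  have hmin : minpoly F y = (minpoly A y).map (algebraMap A F) :=
    minpoly.isIntegrallyClosed_eq_field_fractions' F hyint
  have hderF : Polynomial.aeval y (Polynomial.derivative (minpoly F y)) =
      Polynomial.aeval y (Polynomial.derivative (minpoly A y)) := by
    rw [hmin, Polynomial.derivative_map, Polynomial.aeval_map_algebraMap]
  let B : PowerBasis F E := (IntermediateField.adjoin.powerBasis hyF).map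
    ((IntermediateField.equivOfEq hgen).trans IntermediateField.topEquiv)
  have hB : B.gen = y := by simp [B]
  have : FiniteDimensional F E := B.finite
  have hsep : IsSeparable F y := by
    have h0 : Polynomial.aeval y (Polynomial.derivative (minpoly F y)) ≠ 0 := by
      rw [hderF]; exact left_ne_zero_of_mul_eq_one hder
    exact (Polynomial.separable_iff_derivative_ne_zero (minpoly.irreducible hyF)).2
      (fun h => h0 (by rw [h, map_zero]))
  have : Algebra.IsSeparable F E := by
    have := (IntermediateField.isSeparable_adjoin_simple_iff_isSeparable _ _).2 hsep
    rw [hgen] at this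
    exact AlgEquiv.Algebra.isSeparable IntermediateField.topEquiv
  have hnorm := Algebra.isIntegral_norm (R := A) F
    (x := Polynomial.aeval y (k * Polynomial.X * Polynomial.C (u' * N')))
    (hint _)
  obtain ⟨μ, hμ⟩ := IsIntegrallyClosed.isIntegral_iff.1 hnorm
  -- The discriminant, up to sign the norm of `m'(y)`, multiplies `β` into `A[y]`. Its inverse
  -- `(-1)^m * μ` lies in `A`, because `μ` is the norm of the integral element `m'(y)⁻¹`.
  have hmem := Algebra.discr_mul_isIntegral_mem_adjoin F (B := B) (hB.symm ▸ hyint) hβ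
  rw [Algebra.discr_powerBasis_eq_norm, hB, hderF] at hmem
  set m := Module.finrank F E * (Module.finrank F E - 1) / 2
  have key := congrArg (Algebra.norm F) hder
  rw [map_mul, map_one, ← hμ] at key
  rw [Algebra.adjoin_singleton_eq_range_aeval] at hmem
  obtain ⟨p, hp⟩ := hmem
  refine ⟨Polynomial.C ((-1) ^ m * μ) * p, ?_⟩
  rw [map_mul, Polynomial.aeval_C]
  erw [hp]
  rw [Algebra.smul_def, ← mul_assoc, IsScalarTower.algebraMap_apply A F E, ← map_mul]
  have : algebraMap A F ((-1) ^ m * μ) *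
      ((-1) ^ m * (Algebra.norm F) (Polynomial.aeval y (Polynomial.derivative (minpoly A y)))) = 1 := by
    rw [map_mul, map_pow, map_neg, map_one]
    have : ((-1 : F) ^ m) * (-1) ^ m = 1 := by rw [← mul_pow]; simp
    linear_combination key + algebraMap A F μ *
      (Algebra.norm F) (Polynomial.aeval y (Polynomial.derivative (minpoly A y))) * this
  erw [this]
  simp

end ValuationSubring


/-! ### Residues at rational places -/

namespace Place

variable {K F E : Type*} [Field K] [Field F] [Field E] [Algebra K F] [Algebra K E]

theorem algebraMap_mem (P : Place K F) (a : K) : algebraMap K F a ∈ P.toValuationSubring :=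
  P.algebraMap_mem' a

theorem algebraMap_mem_nonunits_iff (P : Place K F) {a : K} :
    algebraMap K F a ∈ P.toValuationSubring.nonunits ↔ a = 0 := by
  rw [ValuationSubring.mem_nonunits_iff_or, ← map_inv₀]
  simp only [P.algebraMap_mem, not_true_eq_false, or_false, map_eq_zero]

/-- Degree one makes `constMap` bijective, so its inverse can follow the residue map. With values in
`K` itself, polynomials over the valuation ring reduce to `K[X]`. -/
theorem IsRational.exists_residueMap {P : Place K F} (hP : P.IsRational) :
    ∃ ρ : P.toValuationSubring →+* K,
      (∀ z, ρ z = 0 ↔ (z : F) ∈ P.toValuationSubring.nonunits) ∧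
      ∀ a, ρ ⟨algebraMap K F a, P.algebraMap_mem a⟩ = a := by
  have hsurj : Function.Surjective P.constMap := by
    intro w
    let := P.constMap.toModule
    have hP' : Module.finrank K P.ResidueField = 1 := hP
    obtain ⟨c, hc⟩ := (finrank_eq_one_iff_of_nonzero' (1 : P.ResidueField) one_ne_zero).1 hP' w
    refine ⟨c, ?_⟩
    rw [← hc]
    exact (mul_one _).symm
  let e : K ≃+* P.ResidueField := RingEquiv.ofBijective P.constMap ⟨P.constMap.injective, hsurj⟩
  refine ⟨(e.symm : P.ResidueField →+* K).comp (IsLocalRing.residue _), fun z => ?_, fun a => ?_⟩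
  · rw [ValuationSubring.coe_mem_nonunits_iff, ← IsLocalRing.residue_eq_zero_iff]
    simp
  · exact e.symm_apply_apply a

theorem isRational_of_forall_exists {P : Place K F}
    (h : ∀ z ∈ P.toValuationSubring,
      ∃ a : K, z - algebraMap K F a ∈ P.toValuationSubring.nonunits) : P.IsRational := by
  let := P.constMap.toModule
  refine finrank_eq_one (1 : P.ResidueField) one_ne_zero fun w => ?_
  obtain ⟨z, rfl⟩ := IsLocalRing.residue_surjective w
  obtain ⟨a, ha⟩ := h z z.2
  refine ⟨a, ?_⟩
  have h1 : IsLocalRing.residue P.toValuationSubring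
      (z - ⟨algebraMap K F a, P.algebraMap_mem a⟩) = 0 := by
    rw [IsLocalRing.residue_eq_zero_iff, ← ValuationSubring.coe_mem_nonunits_iff]
    exact ha
  rw [map_sub, sub_eq_zero] at h1
  rw [h1]
  exact mul_one _

theorem IsRational.exists_sub_mem_nonunits {P : Place K F} (hP : P.IsRational) {z : F}
    (hz : z ∈ P.toValuationSubring) :
    ∃ a : K, z - algebraMap K F a ∈ P.toValuationSubring.nonunits := by
  obtain ⟨ρ, hρ0, hρK⟩ := hP.exists_residueMap
  refine ⟨ρ ⟨z, hz⟩, (hρ0 (⟨z, hz⟩ - ⟨algebraMap K F (ρ ⟨z, hz⟩), P.algebraMap_mem _⟩)).1 ?_⟩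
  rw [map_sub, hρK, sub_self]

/-- Congruences modulo a place are preserved by polynomials over the constants. -/
theorem aeval_sub_mem_nonunits (P : Place K F) {z : F} {a : K}
    (h : z - algebraMap K F a ∈ P.toValuationSubring.nonunits) (p : K[X]) :
    Polynomial.aeval z p - algebraMap K F (p.eval a) ∈ P.toValuationSubring.nonunits := by
  have hz : z ∈ P.toValuationSubring := by
    simpa using add_mem (ValuationSubring.mem_of_mem_nonunits h) (P.algebraMap_mem a)
  induction p using Polynomial.induction_on' with
  | add p q hp hq =>
    rw [map_add, Polynomial.eval_add, map_add, add_sub_add_comm]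
    exact ValuationSubring.add_mem_nonunits hp hq
  | monomial n c =>
    obtain ⟨d, hd⟩ := sub_dvd_pow_sub_pow (⟨z, hz⟩ : P.toValuationSubring)
      ⟨algebraMap K F a, P.algebraMap_mem a⟩ n
    have hd' : z ^ n - algebraMap K F a ^ n = (z - algebraMap K F a) * d :=
      congrArg Subtype.val hd
    rw [Polynomial.aeval_monomial, Polynomial.eval_monomial, map_mul, map_pow, ← mul_sub, hd']
    refine ValuationSubring.mul_mem_nonunits (P.algebraMap_mem c) ?_
    rw [mul_comm]
    exact ValuationSubring.mul_mem_nonunits d.2 h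

/-! ### The Dedekind–Kummer correspondence for one step -/

section KummerStep

variable [Algebra F E] [IsScalarTower K F E]

/-- Residues of polynomial expressions in an element whose residue is known. -/
theorem aeval_sub_eval_map_mem_nonunits {P : Place K F} {ρ : P.toValuationSubring →+* K}
    (hρ0 : ∀ z, ρ z = 0 ↔ (z : F) ∈ P.toValuationSubring.nonunits)
    (hρK : ∀ a, ρ ⟨algebraMap K F a, P.algebraMap_mem a⟩ = a) {W : Place K E}
    (hW : W.toValuationSubring.comap (algebraMap F E) = P.toValuationSubring) {y : E} {b : K}
    (hb : y - algebraMap K E b ∈ W.toValuationSubring.nonunits) (p : P.toValuationSubring[X]) :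
    Polynomial.aeval y p - algebraMap K E ((p.map ρ).eval b) ∈ W.toValuationSubring.nonunits := by
  have hC : ∀ a : P.toValuationSubring, algebraMap P.toValuationSubring E a -
      algebraMap K E (ρ a) ∈ W.toValuationSubring.nonunits := by
    intro a
    have := (hρ0 (a - ⟨algebraMap K F (ρ a), P.algebraMap_mem _⟩)).1
      (by rw [map_sub, hρK, sub_self])
    rw [← ValuationSubring.map_mem_nonunits_of_comap_eq hW] at this
    rw [IsScalarTower.algebraMap_apply K F E]
    change algebraMap F E (a - algebraMap K F (ρ a)) ∈ _ at this
    rw [map_sub] at this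
    exact this
  have hK : Polynomial.aeval y (p.map ρ) - algebraMap K E ((p.map ρ).eval b) ∈
      W.toValuationSubring.nonunits := W.aeval_sub_mem_nonunits hb _
  have hy : y ∈ W.toValuationSubring := by
    simpa using add_mem (ValuationSubring.mem_of_mem_nonunits hb) (W.algebraMap_mem b)
  -- Two congruences are chained: coefficients are replaced by their residues here, and `y` by `b`
  -- in `hK`.
  suffices h : Polynomial.aeval y p - Polynomial.aeval y (p.map ρ) ∈
      W.toValuationSubring.nonunits by
    simpa using ValuationSubring.add_mem_nonunits h hK
  induction p using Polynomial.induction_on' with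
  | add p q hp hq =>
    rw [map_add, Polynomial.map_add, map_add, add_sub_add_comm]
    exact ValuationSubring.add_mem_nonunits (hp (W.aeval_sub_mem_nonunits hb _))
      (hq (W.aeval_sub_mem_nonunits hb _))
  | monomial n c =>
    rw [Polynomial.aeval_monomial, Polynomial.map_monomial, Polynomial.aeval_monomial,
      ← sub_mul, mul_comm]
    exact ValuationSubring.mul_mem_nonunits (pow_mem hy n) (hC c)

variable {P : Place K F} {y : E} {N : ℕ} {u : P.toValuationSubring}

/-- A place above a rational place `P` is described by the residue of the Kummer generator. -/
theorem mem_iff_of_sub_mem_nonunits {ρ : P.toValuationSubring →+* K}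
    (hρ0 : ∀ z, ρ z = 0 ↔ (z : F) ∈ P.toValuationSubring.nonunits)
    (hρK : ∀ a, ρ ⟨algebraMap K F a, P.algebraMap_mem a⟩ = a)
    (hN : IsUnit (N : P.toValuationSubring)) (hu : IsUnit u)
    (hy : y ^ N = algebraMap P.toValuationSubring E u)
    (hgen : IntermediateField.adjoin F {y} = ⊤) {W : Place K E}
    (hW : W.toValuationSubring.comap (algebraMap F E) = P.toValuationSubring) {b : K}
    (hb : y - algebraMap K E b ∈ W.toValuationSubring.nonunits) (z : E) :
    z ∈ W.toValuationSubring ↔ ∃ s p : P.toValuationSubring[X],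
      (s.map ρ).eval b ≠ 0 ∧ Polynomial.aeval y s * z = Polynomial.aeval y p := by
  have hres := aeval_sub_eval_map_mem_nonunits hρ0 hρK hW hb
  have hiff (s : P.toValuationSubring[X]) : Polynomial.aeval y s ∈ W.toValuationSubring.nonunits ↔
      (s.map ρ).eval b = 0 := by
    rw [← W.algebraMap_mem_nonunits_iff]
    constructor <;> intro h
    · simpa using ValuationSubring.sub_mem_nonunits h (hres s)
    · simpa using ValuationSubring.add_mem_nonunits (hres s) h
  have hmem (s : P.toValuationSubring[X]) : Polynomial.aeval y s ∈ W.toValuationSubring := by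
    simpa using add_mem (ValuationSubring.mem_of_mem_nonunits (hres s))
      (W.algebraMap_mem ((s.map ρ).eval b))
  constructor
  · intro hz
    have hN0 : N ≠ 0 := by
      rintro rfl
      simp at hN
    have hyint : IsIntegral F y := by
      refine IsIntegral.of_pow (Nat.pos_of_ne_zero hN0) ?_
      rw [hy, IsScalarTower.algebraMap_apply P.toValuationSubring F E]; exact isIntegral_algebraMap
    have hzalg : IsAlgebraic F z := by
      have := IntermediateField.isAlgebraic_adjoin_simple hyint
      rw [hgen] at this
      exact (IntermediateField.isAlgebraic_iff (S := (⊤ : IntermediateField F E))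
        (x := ⟨z, trivial⟩)).1 (this.isAlgebraic _)
    -- Write `z` as a fraction of integral elements, both of which lie in `A[y]`. The resulting
    -- criterion no longer mentions `W`, so `b` determines the place.
    obtain ⟨s, hs, hsz, hsW⟩ := ValuationSubring.exists_isIntegral_mul_isIntegral
      (A := P.toValuationSubring) hzalg hz
    obtain ⟨s', rfl⟩ := ValuationSubring.exists_aeval_eq_of_isIntegral hN hu hy hgen hs
    obtain ⟨p', hp'⟩ := ValuationSubring.exists_aeval_eq_of_isIntegral hN hu hy hgen hsz
    exact ⟨s', p', fun h => hsW ((hiff s').2 h), hp'⟩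
  · rintro ⟨s, p, hs, h⟩
    have hs' : Polynomial.aeval y s ∉ W.toValuationSubring.nonunits := fun h => hs ((hiff s).1 h)
    have hs0 : Polynomial.aeval y s ≠ 0 := by
      intro h0
      rw [h0] at hs'
      exact hs' (ValuationSubring.zero_mem_nonunits _)
    rw [← inv_mul_cancel_left₀ hs0 z, h]
    exact mul_mem (ValuationSubring.inv_mem_of_notMem_nonunits hs') (hmem p)

/-- Places above a rational place `P` in a Kummer extension split over the constants are
rational. -/
theorem isRational_of_sub_mem_nonunits {ρ : P.toValuationSubring →+* K}
    (hρ0 : ∀ z, ρ z = 0 ↔ (z : F) ∈ P.toValuationSubring.nonunits)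
    (hρK : ∀ a, ρ ⟨algebraMap K F a, P.algebraMap_mem a⟩ = a)
    (hN : IsUnit (N : P.toValuationSubring)) (hu : IsUnit u)
    (hy : y ^ N = algebraMap P.toValuationSubring E u)
    (hgen : IntermediateField.adjoin F {y} = ⊤) {W : Place K E}
    (hW : W.toValuationSubring.comap (algebraMap F E) = P.toValuationSubring) {b : K}
    (hb : y - algebraMap K E b ∈ W.toValuationSubring.nonunits) : W.IsRational := by
  refine isRational_of_forall_exists fun z hz => ?_
  have hres := aeval_sub_eval_map_mem_nonunits hρ0 hρK hW hb
  obtain ⟨s, p, hs, h⟩ := (mem_iff_of_sub_mem_nonunits hρ0 hρK hN hu hy hgen hW hb z).1 hz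
  set β := (s.map ρ).eval b
  set γ := (p.map ρ).eval b
  -- As `z = p(y)/s(y)`, its residue must be `γ/β`.
  refine ⟨β⁻¹ * γ, ?_⟩
  have hβ : algebraMap K E β ≠ 0 := by simpa using hs
  have h2 : z - algebraMap K E (β⁻¹ * γ) = algebraMap K E β⁻¹ *
      ((Polynomial.aeval y p - algebraMap K E γ) -
        z * (Polynomial.aeval y s - algebraMap K E β)) := by
    rw [← h, map_mul, map_inv₀]
    field_simp
    ring
  rw [h2]
  exact ValuationSubring.mul_mem_nonunits (W.algebraMap_mem _)
    (ValuationSubring.sub_mem_nonunits (hres p) (ValuationSubring.mul_mem_nonunits hz (hres s)))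

/-- Every root of the reduced minimal polynomial comes from a place above `P`. -/
theorem exists_place_of_eval_minpoly_eq_zero {ρ : P.toValuationSubring →+* K}
    (hρ0 : ∀ z, ρ z = 0 ↔ (z : F) ∈ P.toValuationSubring.nonunits)
    (hρK : ∀ a, ρ ⟨algebraMap K F a, P.algebraMap_mem a⟩ = a)
    (hy : IsIntegral P.toValuationSubring y) {b : K}
    (hb : ((minpoly P.toValuationSubring y).map ρ).eval b = 0) :
    ∃ W : Place K E, W.toValuationSubring.comap (algebraMap F E) = P.toValuationSubring ∧
      y - algebraMap K E b ∈ W.toValuationSubring.nonunits := by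
  let A := P.toValuationSubring
  let ψ : A[X] →+* E := (Polynomial.aeval y : A[X] →ₐ[A] E).toRingHom
  let J : Ideal A[X] := RingHom.ker ((Polynomial.evalRingHom b).comp (Polynomial.mapRingHom ρ))
  have hJ (p : A[X]) : p ∈ J ↔ (p.map ρ).eval b = 0 := Iff.rfl
  have hsurj : Function.Surjective ψ.rangeRestrict := ψ.rangeRestrict_surjective
  have hI : J.map ψ.rangeRestrict ≠ ⊤ := by
    rw [Ideal.ne_top_iff_one, Ideal.mem_map_iff_of_surjective _ hsurj]
    rintro ⟨p, hp, hp1⟩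
    have hp1' : Polynomial.aeval y p = 1 := congrArg Subtype.val hp1
    -- If some `p ∈ J` had `p(y) = 1`, the minimal polynomial would divide `p - 1`; reducing and
    -- evaluating at `b` gives `-1 = 0`.
    obtain ⟨k, hk⟩ := minpoly.isIntegrallyClosed_dvd hy (p := p - 1) (by simp [hp1'])
    have := congrArg (fun r => (Polynomial.map ρ r).eval b) hk
    simp [hb, (hJ p).1 hp] at this
  -- Chevalley's extension theorem: a proper ideal of a subring of `E` lies in the nonunits of some
  -- valuation ring containing the subring.
  obtain ⟨W, hAW, hIW⟩ := Ideal.image_subset_nonunits_valuationSubring _ hI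
  have hmem (p : A[X]) : Polynomial.aeval y p ∈ W := hAW ⟨p, rfl⟩
  have hnon (p : A[X]) (hp : (p.map ρ).eval b = 0) : Polynomial.aeval y p ∈ W.nonunits :=
    hIW ⟨ψ.rangeRestrict p, Ideal.mem_map_of_mem _ hp, rfl⟩
  have hcomap : W.comap (algebraMap F E) = A := by
    ext z
    rw [ValuationSubring.mem_comap]
    constructor
    · intro hz
      -- For `z ∉ A` the inverse lies in the maximal ideal of `A`, whose constants belong to `J`;
      -- then `z * z⁻¹ = 1` would be a nonunit of `W`.
      by_contra hzA
      have hz' : z⁻¹ ∈ A.nonunits := by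
        rw [ValuationSubring.inv_mem_nonunits_iff]; exact Or.inr hzA
      have hz0 : z ≠ 0 := by rintro rfl; exact hzA A.zero_mem
      have h := hnon (Polynomial.C ⟨z⁻¹, ValuationSubring.mem_of_mem_nonunits hz'⟩)
        (by rw [Polynomial.map_C, Polynomial.eval_C]; exact (hρ0 _).2 hz')
      rw [Polynomial.aeval_C] at h
      have h' := ValuationSubring.mul_mem_nonunits hz h
      have h1 : algebraMap F E z * algebraMap A E ⟨z⁻¹, ValuationSubring.mem_of_mem_nonunits hz'⟩
          = 1 := by
        rw [IsScalarTower.algebraMap_apply A F E, ← map_mul]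
        simp [hz0]
      rw [h1] at h'
      exact W.one_notMem_nonunits h'
    · intro hz
      have := hmem (Polynomial.C ⟨z, hz⟩)
      rwa [Polynomial.aeval_C] at this
  refine ⟨⟨W, fun a => ?_, ?_⟩, hcomap, ?_⟩
  · rw [IsScalarTower.algebraMap_apply K F E]
    exact (ValuationSubring.map_mem_of_comap_eq hcomap).2 (P.algebraMap_mem a)
  · rintro rfl
    refine P.ne_top' (hcomap.symm.trans ?_)
    ext z
    simp [ValuationSubring.mem_comap]
  · have := hnon (Polynomial.X - Polynomial.C ⟨algebraMap K F b, P.algebraMap_mem b⟩)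
      (by simp [hρK])
    rw [map_sub, Polynomial.aeval_X, Polynomial.aeval_C] at this
    rw [IsScalarTower.algebraMap_apply K F E]
    exact this

/-- One Kummer step `E = F(y)`, `y ^ N = u`: if `u` is congruent modulo the rational place `P` to a
constant `c` with `N` distinct `N`-th roots in `K`, then there are `[E : F]` places above `P`, all
of them rational. -/
theorem ncard_liesAbove_of_kummer (hP : P.IsRational) (hNK : (N : K) ≠ 0) {c : K} (hc : c ≠ 0)
    (huc : (u : F) - algebraMap K F c ∈ P.toValuationSubring.nonunits)
    (hroots : (Polynomial.nthRoots N c).card = N)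
    (hy : y ^ N = algebraMap F E u)
    (hgen : IntermediateField.adjoin F {y} = ⊤) :
    FiniteDimensional F E ∧
    {W : Place K E | W.toValuationSubring.comap (algebraMap F E) = P.toValuationSubring}.ncard =
      Module.finrank F E ∧
    ∀ W : Place K E, W.toValuationSubring.comap (algebraMap F E) = P.toValuationSubring →
      W.IsRational := by
  classical
  obtain ⟨ρ, hρ0, hρK⟩ := hP.exists_residueMap
  replace hy : y ^ N = algebraMap P.toValuationSubring E u := hy
  have hN0 : N ≠ 0 := by
    rintro rfl
    simp at hNK
  have hρu : ρ u = c := by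
    rw [← sub_eq_zero]
    conv_lhs => rw [← hρK c, ← map_sub]
    exact (hρ0 _).2 huc
  have hunit (a : P.toValuationSubring) (ha : ρ a ≠ 0) : IsUnit a := by
    rw [Ne, hρ0, ValuationSubring.coe_mem_nonunits_iff] at ha
    exact IsLocalRing.notMem_maximalIdeal.1 ha
  have hu : IsUnit u := hunit u (hρu ▸ hc)
  have hN : IsUnit (N : P.toValuationSubring) := hunit _ (by simpa using hNK)
  have hyint : IsIntegral P.toValuationSubring y := by
    refine IsIntegral.of_pow (Nat.pos_of_ne_zero hN0) ?_
    rw [hy]; exact isIntegral_algebraMap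
  have hyF : IsIntegral F y := hyint.tower_top
  have hfin : FiniteDimensional F E := by
    have := IntermediateField.adjoin.finiteDimensional hyF
    rw [hgen] at this
    exact Module.Finite.equiv (IntermediateField.topEquiv (F := F) (E := E)).toLinearEquiv
  have hroot : Polynomial.aeval y (Polynomial.X ^ N - Polynomial.C u) = 0 := by simp [hy]
  have hdvd : (minpoly P.toValuationSubring y).map ρ ∣ Polynomial.X ^ N - Polynomial.C c := by
    have := Polynomial.map_dvd ρ (minpoly.isIntegrallyClosed_dvd hyint hroot)
    simpa [hρu] using this
  have hXN : (Polynomial.X ^ N - Polynomial.C c : K[X]) ≠ 0 :=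
    Polynomial.X_pow_sub_C_ne_zero (Nat.pos_of_ne_zero hN0) c
  have hsplit : (Polynomial.X ^ N - Polynomial.C c : K[X]).Splits := by
    rw [Polynomial.splits_iff_card_roots, Polynomial.natDegree_X_pow_sub_C]
    exact hroots
  have hsepK : (Polynomial.X ^ N - Polynomial.C c : K[X]).Separable :=
    Polynomial.separable_X_pow_sub_C c hNK hc
  -- Counting roots of this factor rather than of `X ^ N - C c` gives exactly `[E : F]`, whether or
  -- not that degree is `N`.
  set f := (minpoly P.toValuationSubring y).map ρ with hf
  have hf0 : f ≠ 0 := ne_zero_of_dvd_ne_zero hXN hdvd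
  have hfdeg : f.natDegree = Module.finrank F E := by
    rw [hf, (minpoly.monic hyint).natDegree_map]
    have h1 : minpoly F y = (minpoly P.toValuationSubring y).map (algebraMap _ F) :=
      minpoly.isIntegrallyClosed_eq_field_fractions' F hyint
    rw [← (minpoly.monic hyint).natDegree_map (algebraMap P.toValuationSubring F), ← h1,
      ← IntermediateField.adjoin.finrank hyF, hgen, IntermediateField.finrank_top']
  have hcard : f.roots.toFinset.card = Module.finrank F E := by
    rw [Multiset.toFinset_card_of_nodup (Polynomial.nodup_roots (hsepK.of_dvd hdvd)), ← hfdeg]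
    exact (Polynomial.splits_iff_card_roots.1 (hsplit.of_dvd hXN hdvd))
  have hex (W : Place K E)
      (hW : W.toValuationSubring.comap (algebraMap F E) = P.toValuationSubring) :
      ∃ b ∈ f.roots.toFinset, y - algebraMap K E b ∈ W.toValuationSubring.nonunits := by
    -- Modulo `W`, `0 ≡ y^N - c = ∏ (y - b)`, so some factor is a nonunit. Reducing `m(y) = 0` then
    -- shows that this `b` is a root of `f`.
    have hprod : (Polynomial.X ^ N - Polynomial.C c : K[X]) =
        ((Polynomial.nthRoots N c).map fun a => Polynomial.X - Polynomial.C a).prod :=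
      hsplit.eq_prod_roots_of_monic (Polynomial.monic_X_pow_sub_C c hN0)
    have h1 := congrArg (Polynomial.aeval y) hprod
    rw [map_multiset_prod, Multiset.map_map] at h1
    have h2 : Polynomial.aeval y (Polynomial.X ^ N - Polynomial.C c : K[X]) ∈
        W.toValuationSubring.nonunits := by
      have := (ValuationSubring.map_mem_nonunits_of_comap_eq hW).2 huc
      rw [map_sub, ← IsScalarTower.algebraMap_apply K F E] at this
      rw [map_sub, map_pow, Polynomial.aeval_X, Polynomial.aeval_C, hy]
      exact this
    rw [h1] at h2
    obtain ⟨z, hz, hzW⟩ := ValuationSubring.exists_mem_nonunits_of_multiset_prod _ h2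
    obtain ⟨b, -, rfl⟩ := Multiset.mem_map.1 hz
    simp only [Function.comp_apply, map_sub, Polynomial.aeval_X, Polynomial.aeval_C] at hzW
    refine ⟨b, ?_, hzW⟩
    rw [Multiset.mem_toFinset, Polynomial.mem_roots hf0, Polynomial.IsRoot.def]
    have h3 := aeval_sub_eval_map_mem_nonunits hρ0 hρK hW hzW (minpoly P.toValuationSubring y)
    rw [minpoly.aeval, zero_sub, ← map_neg, W.algebraMap_mem_nonunits_iff, neg_eq_zero] at h3
    exact h3
  refine ⟨hfin, ?_, fun W hW => ?_⟩
  · rw [← hcard, ← Set.ncard_coe_finset]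
    choose! r hr hr' using hex
    refine Set.ncard_congr (fun W _ => r W) (fun W hW => hr W hW) ?_ ?_
    · intro W W' hW hW' h
      refine Place.ext (Set.ext fun z => ?_)
      have h' := hr' W' hW'
      rw [← h] at h'
      exact (mem_iff_of_sub_mem_nonunits hρ0 hρK hN hu hy hgen hW (hr' W hW) z).trans
        (mem_iff_of_sub_mem_nonunits hρ0 hρK hN hu hy hgen hW' h' z).symm
    · intro b hb
      rw [Finset.mem_coe, Multiset.mem_toFinset, Polynomial.mem_roots hf0] at hb
      obtain ⟨W, hW, hWb⟩ := exists_place_of_eval_minpoly_eq_zero hρ0 hρK hyint hb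
      refine ⟨W, hW, ?_⟩
      have := ValuationSubring.sub_mem_nonunits (hr' W hW) hWb
      rw [sub_sub_sub_cancel_left, ← map_sub, W.algebraMap_mem_nonunits_iff, sub_eq_zero] at this
      exact this.symm
  · obtain ⟨b, -, hb⟩ := hex W hW
    exact isRational_of_sub_mem_nonunits hρ0 hρK hN hu hy hgen hW hb

end KummerStep

end Place


/-! ### Finite fields: values in `𝔽_q` and their `N`-th roots -/

/-- The number `(q ^ n - 1) / (q - 1)` is an exact quotient. -/
theorem pow_sub_one_div_mul (q n : ℕ) : (q ^ n - 1) / (q - 1) * (q - 1) = q ^ n - 1 := by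
  refine Nat.div_mul_cancel ?_
  simpa using Nat.sub_dvd_pow_sub_pow q 1 n

section FiniteField

variable {q n : ℕ} {Fq K : Type*} [Field Fq] [Finite Fq] [Field K] [Finite K] [Algebra Fq K]

/-- Values of quasi-symmetric polynomials with coefficients in `𝔽_q` are fixed by Frobenius. -/
theorem IsNQQuasiSymmetric.eval_pow_eq (hq : Nat.card Fq = q) (hK : Nat.card K = q ^ n) {g : K[X]}
    (hg : IsNQQuasiSymmetric n q g) (hgq : g ∈ Polynomial.lifts (algebraMap Fq K)) (a : K) :
    g.eval a ^ q = g.eval a := by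
  have := Fintype.ofFinite Fq
  have := Fintype.ofFinite K
  have haq : a ^ q ^ n = a := by
    rw [← hK, Nat.card_eq_fintype_card, FiniteField.pow_card]
  have hfrob : g.eval a ^ q = g.eval (a ^ q) := by
    obtain ⟨g₀, rfl⟩ := hgq
    have h := Polynomial.aeval_algHom_apply (FiniteField.frobeniusAlgHom Fq K) a g₀
    simp only [FiniteField.frobeniusAlgHom_apply, ← Nat.card_eq_fintype_card, hq] at h
    rw [Polynomial.coe_mapRingHom, Polynomial.eval_map_algebraMap, Polynomial.eval_map_algebraMap,
      h]
  obtain ⟨f, hf, rfl⟩ := hg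
  have heval (b : K) : (MvPolynomial.aeval (fun i : Fin n => (Polynomial.X : K[X]) ^ q ^ (i : ℕ))
      f).eval b = MvPolynomial.aeval (fun i : Fin n => b ^ q ^ (i : ℕ)) f := by
    have := MvPolynomial.comp_aeval_apply (fun i : Fin n => (Polynomial.X : K[X]) ^ q ^ (i : ℕ))
      (Polynomial.aeval b) f
    simpa using this
  rw [hfrob, heval, heval]
  -- Replacing `a` by `a^q` shifts the tuple of conjugates by one; `a^(q^n) = a` closes the cycle at
  -- the last index.
  conv_rhs => rw [← (show MvPolynomial.rename (finRotate n) f = f from hf)]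
  rw [MvPolynomial.aeval_rename]
  congr 2
  funext i
  obtain ⟨m, rfl⟩ : ∃ m, n = m + 1 := ⟨n - 1, by have := i.2; omega⟩
  rw [Function.comp_apply, coe_finRotate, ← pow_mul, ← pow_succ']
  split_ifs with h
  · subst h; simpa using haq
  · rfl

/-- Nonzero elements of `𝔽_q` have `N = (q ^ n - 1) / (q - 1)` distinct `N`-th roots in
`𝔽_{q ^ n}`. -/
theorem card_nthRoots_of_pow_eq_self (hq : 1 < q) (hK : Nat.card K = q ^ n)
    {c : K} (hc0 : c ≠ 0) (hc : c ^ q = c) :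
    (Polynomial.nthRoots ((q ^ n - 1) / (q - 1)) c).card = (q ^ n - 1) / (q - 1) := by
  set N := (q ^ n - 1) / (q - 1)
  have hNq : N * (q - 1) = q ^ n - 1 := pow_sub_one_div_mul q n
  have hcard : Nat.card Kˣ = N * (q - 1) := by rw [hNq, ← hK, Nat.card_units]
  obtain ⟨γ, hγ⟩ := IsCyclic.exists_generator (α := Kˣ)
  have hord : orderOf γ = N * (q - 1) := by rw [orderOf_eq_card_of_forall_mem_zpowers hγ, hcard]
  have hNpos : 0 < N * (q - 1) := hord ▸ orderOf_pos γ
  -- With all `N`-th roots of unity in `K`, the number of roots is `0` or `N`, so a single root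
  -- suffices.
  have hprim : IsPrimitiveRoot ((γ : K) ^ (q - 1)) N := by
    have h1 : IsPrimitiveRoot (γ : K) (N * (q - 1)) := by
      rw [IsPrimitiveRoot.coe_units_iff, ← hord]
      exact IsPrimitiveRoot.orderOf γ
    exact h1.pow hNpos (mul_comm _ _)
  rw [hprim.card_nthRoots, if_pos]
  obtain ⟨e, he⟩ := (mem_powers_iff_mem_zpowers (x := γ)).2 (hγ (Units.mk0 c hc0))
  have he' : γ ^ e = Units.mk0 c hc0 := he
  -- From `c = γ^e` and `c^(q-1) = 1`, the order `N (q-1)` divides `e (q-1)`. Hence `N ∣ e`, and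
  -- `γ^(e/N)` is a root.
  have h1 : γ ^ (e * (q - 1)) = 1 := by
    rw [pow_mul, he']
    ext
    rw [Units.val_pow_eq_pow_val, Units.val_mk0, Units.val_one]
    refine mul_right_cancel₀ hc0 ?_
    rw [← pow_succ, Nat.sub_add_cancel hq.le, one_mul, hc]
  have h2 : N ∣ e := by
    rw [← orderOf_dvd_iff_pow_eq_one, hord] at h1
    exact Nat.dvd_of_mul_dvd_mul_right (by omega) h1
  obtain ⟨m, rfl⟩ := h2
  refine ⟨(γ : K) ^ m, ?_⟩
  rw [← pow_mul, mul_comm, ← Units.val_pow_eq_pow_val, he', Units.val_mk0]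

/-- In `K`, `N * (q - 1) = q^n - 1 = -1`, because the cardinality of `K` vanishes there. -/
theorem cast_pow_sub_one_div_ne_zero (hK : Nat.card K = q ^ n) :
    (((q ^ n - 1) / (q - 1) : ℕ) : K) ≠ 0 := by
  have := Fintype.ofFinite K
  intro h
  have h1 := congrArg (fun m : ℕ => (m : K)) (pow_sub_one_div_mul q n)
  have hpos : 1 ≤ q ^ n := hK ▸ Nat.card_pos
  simp only [Nat.cast_mul, h, zero_mul, Nat.cast_sub hpos] at h1
  rw [← hK, Nat.card_eq_fintype_card, FiniteField.cast_card_eq_zero] at h1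
  simp at h1

end FiniteField

/-! ### Composing extensions -/

namespace Place

variable {K F E L : Type*} [Field K] [Field F] [Field E] [Field L] [Algebra K F] [Algebra K E]
  [Algebra K L]

/-- Congruences modulo a place are preserved by rational functions over the constants whose
denominator does not vanish. -/
theorem aeval_div_aeval_sub_mem_nonunits (P : Place K F) {z : F} {a : K}
    (h : z - algebraMap K F a ∈ P.toValuationSubring.nonunits) (p : K[X]) {r : K[X]}
    (hr : r.eval a ≠ 0) :
    Polynomial.aeval z p / Polynomial.aeval z r - algebraMap K F (p.eval a / r.eval a) ∈
      P.toValuationSubring.nonunits := by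
  have hp := P.aeval_sub_mem_nonunits h p
  have hr' := P.aeval_sub_mem_nonunits h r
  have hrn : Polynomial.aeval z r ∉ P.toValuationSubring.nonunits := by
    intro h'
    have := ValuationSubring.sub_mem_nonunits h' hr'
    rw [sub_sub_cancel, P.algebraMap_mem_nonunits_iff] at this
    exact hr this
  have hr0 : Polynomial.aeval z r ≠ 0 := by
    intro h0
    rw [h0] at hrn
    exact hrn (ValuationSubring.zero_mem_nonunits _)
  have hra : algebraMap K F (r.eval a) ≠ 0 := by simpa using hr
  have hEq : Polynomial.aeval z p / Polynomial.aeval z r - algebraMap K F (p.eval a / r.eval a) =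
      (Polynomial.aeval z r)⁻¹ * ((Polynomial.aeval z p - algebraMap K F (p.eval a)) -
        algebraMap K F (p.eval a / r.eval a) *
          (Polynomial.aeval z r - algebraMap K F (r.eval a))) := by
    rw [map_div₀]
    field_simp
    ring
  rw [hEq]
  exact ValuationSubring.mul_mem_nonunits (ValuationSubring.inv_mem_of_notMem_nonunits hrn)
    (ValuationSubring.sub_mem_nonunits hp
      (ValuationSubring.mul_mem_nonunits (P.algebraMap_mem _) hr'))

/-- The middle place is the restriction of `R` to `E`; it is proper because its restriction to `F`
is. -/
theorem liesAbove_comp_iff {φ : F →ₐ[K] E} {ψ : E →ₐ[K] L} {P : Place K F} {R : Place K L} :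
    LiesAbove (ψ.comp φ) R P ↔ ∃ Q : Place K E, LiesAbove φ Q P ∧ LiesAbove ψ R Q := by
  constructor
  · intro hR
    refine ⟨⟨R.toValuationSubring.comap (ψ : E →+* L), fun a => ?_, fun htop => ?_⟩, hR, rfl⟩
    · have := R.algebraMap_mem a
      rw [← ψ.commutes] at this
      exact this
    · refine P.ne_top' ?_
      rw [← show _ = P.toValuationSubring from hR]
      ext z
      have : φ z ∈ R.toValuationSubring.comap (ψ : E →+* L) := by rw [htop]; trivial
      exact iff_of_true this trivial
  · rintro ⟨Q, hQ, hR⟩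
    have hR' : R.toValuationSubring.comap (ψ : E →+* L) = Q.toValuationSubring := hR
    have hQ' : Q.toValuationSubring.comap (φ : F →+* E) = P.toValuationSubring := hQ
    rw [← hR'] at hQ'
    exact hQ'

theorem eq_of_toValuationSubring_eq {P Q : Place K F}
    (h : P.toValuationSubring = Q.toValuationSubring) : P = Q :=
  Place.ext (congrArg (fun A : ValuationSubring F => (A : Set F)) h)

theorem LiesAbove.mem_iff {φ : F →ₐ[K] E} {P : Place K F} {Q : Place K E} (h : LiesAbove φ Q P)
    {z : F} : φ z ∈ Q.toValuationSubring ↔ z ∈ P.toValuationSubring := by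
  rw [← show _ = P.toValuationSubring from h]
  exact Iff.rfl

/-- If a place `P` of `F` splits completely in `E`, and all the places of `E` above `P` split
completely in `L`, then `P` splits completely in `L`. -/
theorem SplitsCompletely.trans {φ : F →ₐ[K] E} {ψ : E →ₐ[K] L} {P : Place K F}
    (hP : P.SplitsCompletely φ) (hψ : ∀ Q : Place K E, LiesAbove φ Q P → Q.SplitsCompletely ψ) :
    P.SplitsCompletely (ψ.comp φ) := by
  let : Algebra F E := (φ : F →+* E).toAlgebra
  let : Algebra E L := (ψ : E →+* L).toAlgebra
  let : Algebra F L := ((ψ.comp φ : F →ₐ[K] L) : F →+* L).toAlgebra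
  have : IsScalarTower F E L := IsScalarTower.of_algebraMap_eq fun _ => rfl
  obtain ⟨hfin, hcard⟩ : FiniteDimensional F E ∧
    {Q : Place K E | LiesAbove φ Q P}.ncard = Module.finrank F E := hP
  set T := {Q : Place K E | LiesAbove φ Q P}
  replace hψ (Q : Place K E) (hQ : Q ∈ T) : FiniteDimensional E L ∧
    {R : Place K L | LiesAbove ψ R Q}.ncard = Module.finrank E L := hψ Q hQ
  -- `ncard` is `0` on infinite sets, so equality with a positive degree yields both finiteness and
  -- nonemptiness.
  have hT : T.Finite := Set.finite_of_ncard_pos (hcard ▸ Module.finrank_pos)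
  obtain ⟨Q₀, hQ₀⟩ : T.Nonempty := (Set.ncard_pos hT).1 (hcard ▸ Module.finrank_pos)
  have : FiniteDimensional E L := (hψ Q₀ hQ₀).1
  change FiniteDimensional F L ∧
    {R : Place K L | LiesAbove (ψ.comp φ) R P}.ncard = Module.finrank F L
  refine ⟨FiniteDimensional.trans F E L, ?_⟩
  have hunion : {R : Place K L | LiesAbove (ψ.comp φ) R P} =
      ⋃ Q ∈ T, {R : Place K L | LiesAbove ψ R Q} := by
    ext R
    simp only [Set.mem_iUnion, exists_prop]
    exact liesAbove_comp_iff
  rw [hunion, Set.Finite.ncard_biUnion hT, finsum_mem_congr rfl fun Q hQ => (hψ Q hQ).2,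
    finsum_mem_eq_finite_toFinset_sum _ hT, Finset.sum_const, ← Set.ncard_eq_toFinset_card _ hT,
    hcard, smul_eq_mul, Module.finrank_mul_finrank]
  · exact fun Q hQ => Set.finite_of_ncard_pos ((hψ Q hQ).2 ▸ Module.finrank_pos)
  · intro Q _ Q' _ hne
    exact Set.disjoint_left.2 fun R hR hR' =>
      hne (eq_of_toValuationSubring_eq (Eq.trans (Eq.symm hR) hR'))

theorem splitsCompletely_id (P : Place K F) : P.SplitsCompletely (AlgHom.id K F) := by
  change FiniteDimensional F F ∧
    {Q : Place K F | LiesAbove (AlgHom.id K F) Q P}.ncard = Module.finrank F F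
  refine ⟨inferInstance, ?_⟩
  rw [Module.finrank_self, Set.ncard_eq_one]
  exact ⟨P, Set.eq_singleton_iff_unique_mem.2
    ⟨rfl, fun Q hQ => eq_of_toValuationSubring_eq hQ⟩⟩

/-- `P` splits completely in `E`, and all the places above `P` are rational. -/
def SplitsRationally (φ : F →ₐ[K] E) (P : Place K F) : Prop :=
  P.SplitsCompletely φ ∧ ∀ Q : Place K E, LiesAbove φ Q P → Q.IsRational

theorem IsRational.splitsRationally_id {P : Place K F} (hP : P.IsRational) :
    P.SplitsRationally (AlgHom.id K F) :=
  ⟨P.splitsCompletely_id, fun Q hQ => by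
    rwa [show Q = P from eq_of_toValuationSubring_eq hQ]⟩

/-- Carrying rationality along is what lets the next Kummer step apply to every place above `P`. -/
theorem SplitsRationally.trans {φ : F →ₐ[K] E} {ψ : E →ₐ[K] L} {P : Place K F}
    (hP : P.SplitsRationally φ)
    (hψ : ∀ Q : Place K E, LiesAbove φ Q P → Q.IsRational → Q.SplitsRationally ψ) :
    P.SplitsRationally (ψ.comp φ) := by
  refine ⟨hP.1.trans fun Q hQ => (hψ Q hQ (hP.2 Q hQ)).1, fun R hR => ?_⟩
  obtain ⟨Q, hQ, hRQ⟩ := liesAbove_comp_iff.1 hR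
  exact (hψ Q hQ (hP.2 Q hQ)).2 R hRQ

end Place

/-! ### The tower: regular generators and a single step -/

section Tower

variable {K Ω : Type*} [Field K] [Field Ω] [Algebra K Ω] {x : ℕ → Ω} {g h : K[X]}

/-- The generator `x_i` as an element of `F_j`. -/
def towerGen (K : Type*) {Ω : Type*} [Field K] [Field Ω] [Algebra K Ω] (x : ℕ → Ω)
    {i j : ℕ} (hi : 1 ≤ i) (hij : i ≤ j) : towerField K x j :=
  ⟨x i, mem_towerField K x hi hij⟩

theorem towerGen_pow_eq {N : ℕ}
    (hx : ∀ i, 1 ≤ i → x (i + 1) ^ N = Polynomial.aeval (x i) g / Polynomial.aeval (x i) h)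
    {i j : ℕ} (hi : 1 ≤ i) (hij : i + 1 ≤ j) :
    towerGen K x (Nat.le_add_left 1 i) hij ^ N =
      Polynomial.aeval (towerGen K x hi (i.le_succ.trans hij)) g /
        Polynomial.aeval (towerGen K x hi (i.le_succ.trans hij)) h := by
  refine Subtype.ext ?_
  have hcoe (p : K[X]) : ((Polynomial.aeval (towerGen K x hi (i.le_succ.trans hij)) p :
      towerField K x j) : Ω) = Polynomial.aeval (x i) p :=
    (Polynomial.aeval_algHom_apply (towerField K x j).val _ p).symm
  push_cast
  rw [hcoe, hcoe]
  exact hx i hi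

/-- All the generators are regular at a rational place that is not a pole of `x_1`. -/
theorem towerGen_mem_of_isRational {N : ℕ} (hN : N ≠ 0)
    (hx : ∀ i, 1 ≤ i → x (i + 1) ^ N = Polynomial.aeval (x i) g / Polynomial.aeval (x i) h)
    (hh0 : ∀ a : K, h.eval a ≠ 0) {j : ℕ} (hj : 1 ≤ j) {P : Place K (towerField K x j)}
    (hP : P.IsRational) (hP1 : towerGen K x le_rfl hj ∈ P.toValuationSubring) {i : ℕ}
    (hi : 1 ≤ i) (hij : i ≤ j) : towerGen K x hi hij ∈ P.toValuationSubring := by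
  induction i, hi using Nat.le_induction with
  | base => exact hP1
  | succ i hi ih =>
    -- Since `h(a) ≠ 0`, the quotient `g(x_i)/h(x_i)` is regular; it is the `N`-th power of
    -- `x_{i+1}`, and valuation rings are closed under extracting roots.
    obtain ⟨a, ha⟩ := hP.exists_sub_mem_nonunits (ih (i.le_succ.trans hij))
    refine ValuationSubring.mem_of_pow_mem hN ?_
    rw [towerGen_pow_eq hx hi hij]
    simpa using add_mem (ValuationSubring.mem_of_mem_nonunits
      (P.aeval_div_aeval_sub_mem_nonunits ha g (hh0 a))) (P.algebraMap_mem (g.eval a / h.eval a))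

/-- If `T` is generated by `S` and `y`, then `T = S(y)`. -/
theorem IntermediateField.adjoin_eq_top_of_adjoin_le {S T : IntermediateField K Ω} (hST : S ≤ T)
    {y : T} {s : Set Ω} (hT : T ≤ IntermediateField.adjoin K s)
    (hs : ∀ z ∈ s, z ∈ S ∨ z = y) :
    letI := (IntermediateField.inclusion hST : S →+* T).toAlgebra
    IntermediateField.adjoin S {y} = ⊤ := by
  let : Algebra S T := (IntermediateField.inclusion hST : S →+* T).toAlgebra
  have : IsScalarTower K S T := IsScalarTower.of_algebraMap_eq fun _ => rfl
  let M : IntermediateField S T := IntermediateField.adjoin S {y}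
  have hle : T ≤ (M.restrictScalars K).map T.val := by
    refine hT.trans (IntermediateField.adjoin_le_iff.2 fun z hz => ?_)
    rcases hs z hz with h | rfl
    · exact ⟨⟨z, hST h⟩, M.algebraMap_mem ⟨z, h⟩, rfl⟩
    · exact ⟨y, IntermediateField.mem_adjoin_simple_self S y, rfl⟩
  refine top_unique fun z _ => ?_
  obtain ⟨w, hw, hwz⟩ := hle z.2
  rw [← show w = z from Subtype.ext hwz]
  exact hw

/-- `F_{i + 1} = F_i(x_{i + 1})`. -/
theorem adjoin_towerGen_eq_top (i : ℕ) :
    letI := (IntermediateField.inclusion (towerField_mono K x i.le_succ) :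
      towerField K x i →+* towerField K x (i + 1)).toAlgebra
    IntermediateField.adjoin (towerField K x i)
      {towerGen K x (Nat.le_add_left 1 i) le_rfl} = ⊤ := by
  refine IntermediateField.adjoin_eq_top_of_adjoin_le _ (s := x '' Set.Icc 1 (i + 1)) le_rfl ?_
  rintro _ ⟨k, ⟨hk1, hk⟩, rfl⟩
  rcases Nat.lt_or_ge i k with hik | hik
  · obtain rfl : k = i + 1 := le_antisymm hk hik
    exact Or.inr rfl
  · exact Or.inl (mem_towerField K x hk1 hik)

/-- One step of the tower: a rational place that is not a pole of `x_1` splits completely, and the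
places above it are rational. -/
theorem splitsRationally_succ [Finite K] {q n : ℕ} {Fq : Type*} [Field Fq] [Finite Fq]
    [Algebra Fq K] (hq : Nat.card Fq = q)
    (hK : Nat.card K = q ^ n) (hg : IsNQQuasiSymmetric n q g) (hh : IsNQQuasiSymmetric n q h)
    (hgq : g ∈ Polynomial.lifts (algebraMap Fq K)) (hhq : h ∈ Polynomial.lifts (algebraMap Fq K))
    (hg0 : ∀ a : K, g.eval a ≠ 0) (hh0 : ∀ a : K, h.eval a ≠ 0)
    (hx : ∀ i, 1 ≤ i → x (i + 1) ^ ((q ^ n - 1) / (q - 1)) =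
      Polynomial.aeval (x i) g / Polynomial.aeval (x i) h)
    {i : ℕ} (hi : 1 ≤ i) {P : Place K (towerField K x i)}
    (hP : P.IsRational) (hP1 : towerGen K x le_rfl hi ∈ P.toValuationSubring) :
    P.SplitsRationally (IntermediateField.inclusion (towerField_mono K x i.le_succ)) := by
  let : Algebra (towerField K x i) (towerField K x (i + 1)) :=
    (IntermediateField.inclusion (towerField_mono K x i.le_succ) :
      towerField K x i →+* towerField K x (i + 1)).toAlgebra
  have : IsScalarTower K (towerField K x i) (towerField K x (i + 1)) :=
    IsScalarTower.of_algebraMap_eq fun _ => rfl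
  have hq1 : 1 < q := hq ▸ Finite.one_lt_card
  have hNK : (((q ^ n - 1) / (q - 1) : ℕ) : K) ≠ 0 :=
    cast_pow_sub_one_div_ne_zero hK
  have hN0 : (q ^ n - 1) / (q - 1) ≠ 0 := by
    intro h
    simp [h] at hNK
  obtain ⟨a, ha⟩ := hP.exists_sub_mem_nonunits
    (towerGen_mem_of_isRational hN0 hx hh0 hi hP hP1 hi le_rfl)
  have hres := P.aeval_div_aeval_sub_mem_nonunits ha g (hh0 a)
  -- Here quasi-symmetry enters: numerator and denominator of the residue are both fixed by `q`-th
  -- powers.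
  have hroots := card_nthRoots_of_pow_eq_self (c := g.eval a / h.eval a) hq1 hK
    (div_ne_zero (hg0 a) (hh0 a))
    (by rw [div_pow, hg.eval_pow_eq hq hK hgq, hh.eval_pow_eq hq hK hhq])
  have hu : Polynomial.aeval (towerGen K x hi le_rfl) g /
      Polynomial.aeval (towerGen K x hi le_rfl) h ∈ P.toValuationSubring := by
    simpa using add_mem (ValuationSubring.mem_of_mem_nonunits hres)
      (P.algebraMap_mem (g.eval a / h.eval a))
  have hpow : towerGen K x (Nat.le_add_left 1 i) le_rfl ^ ((q ^ n - 1) / (q - 1)) =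
      algebraMap (towerField K x i) (towerField K x (i + 1))
        (Polynomial.aeval (towerGen K x hi le_rfl) g /
          Polynomial.aeval (towerGen K x hi le_rfl) h) := by
    rw [towerGen_pow_eq hx hi le_rfl, map_div₀, ← Polynomial.aeval_algebraMap_apply,
      ← Polynomial.aeval_algebraMap_apply]
    rfl
  obtain ⟨hfin, hcard, hrat⟩ := Place.ncard_liesAbove_of_kummer (u := ⟨_, hu⟩) hP hNK
    (div_ne_zero (hg0 a) (hh0 a)) hres hroots hpow (adjoin_towerGen_eq_top i)
  exact ⟨⟨hfin, hcard⟩, hrat⟩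

end Tower

end

theorem mainTheorem10
    -- the finite fields with `q` and `q ^ n` elements
    (q n : ℕ) (hn : 1 < n)
    {Fq K : Type*} [Field Fq] [Finite Fq] [Field K] [Finite K] [Algebra Fq K]
    (hq : Nat.card Fq = q) (hK : Nat.card K = q ^ n)
    -- the polynomials `g` and `h`
    (g h : K[X])
    (hg : IsNQQuasiSymmetric n q g) (hh : IsNQQuasiSymmetric n q h)
    (hgq : g ∈ Polynomial.lifts (algebraMap Fq K)) (hhq : h ∈ Polynomial.lifts (algebraMap Fq K))
    (hg0 : ∀ a : K, g.eval a ≠ 0) (hh0 : ∀ a : K, h.eval a ≠ 0)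
    (hdeg : g.natDegree ≠ h.natDegree)
    -- the tower `F_i = K(x_1, …, x_i)`, `i ≥ 1`
    {Ω : Type*} [Field Ω] [Algebra K Ω] (x : ℕ → Ω)
    (hx1 : Transcendental K (x 1))
    (hx : ∀ i, 1 ≤ i → x (i + 1) ^ ((q ^ n - 1) / (q - 1)) =
      Polynomial.aeval (x i) g / Polynomial.aeval (x i) h)
    (hpow : ∀ i, 1 ≤ i → ∀ w ∈ towerField K x i,
      Polynomial.aeval (x i) g / Polynomial.aeval (x i) h ≠ w ^ ((q ^ n - 1) / (q - 1))) :
    -- a place of `F_i` lies above the pole `P_∞` of `x_1` in `F_1` iff it is a pole of `x_1`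
    ∀ (i j : ℕ) (hi : 1 ≤ i) (hij : i ≤ j) (P : Place K (towerField K x i)),
      P.IsRational → ¬ P.IsPole ⟨x 1, mem_towerField K x le_rfl hi⟩ →
        P.SplitsCompletely (IntermediateField.inclusion (towerField_mono K x hij)) := by
  intro i j hi hij P hP hpole
  have hP1 : towerGen K x le_rfl hi ∈ P.toValuationSubring := not_not.1 hpole
  -- Complete splitting alone would not propagate, because each step needs a rational place below.
  suffices h' : P.SplitsRationally (IntermediateField.inclusion (towerField_mono K x hij)) from h'.1
  induction j, hij using Nat.le_induction with
  | base => exact hP.splitsRationally_id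
  | succ j hij ih =>
    have hcomp : IntermediateField.inclusion (towerField_mono K x (hij.trans j.le_succ)) =
        (IntermediateField.inclusion (towerField_mono K x j.le_succ)).comp
          (IntermediateField.inclusion (towerField_mono K x hij)) := AlgHom.ext fun _ => rfl
    rw [hcomp]
    -- The place `Q` restricts to `P`, so `x_1` stays regular at `Q`.
    exact ih.trans fun Q hQ hQr => splitsRationally_succ hq hK hg hh hgq hhq hg0 hh0 hx
      (hi.trans hij) hQr (hQ.mem_iff.2 hP1)
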